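/- Let $K$ be an algebraically closed field of characteristic zero and let $H$ be a finite-dimensional semisimple Hopf algebra over $K$, of dimension $n$, with multiplication $m$, comultiplication $\Delta$, counit $\varepsilon$ and antipode $S$. Let $\Lambda \in H$ be the integral (that is, $h\Lambda = \varepsilon(h)\Lambda$ for all $h \in H$) normalized by $\varepsilon(\Lambda) = n$, and put $\nu = \sum_{(\Lambda)} \Lambda_1 \otimes S(\Lambda_2) \in H \otimes_K H$. Let $M$ be a simple $H$-module, of dimension $k$ over $K$. For a subring $R \subseteq K$, a weak $R$-form of $H$ is a free $R$-submodule $H_R \subseteq H$ with an $R$-basis $x_1, \dots, x_n$ that is also a $K$-basis of $H$, such that in the expansions $x_i x_j = \sum_{l} m_{i,j}^{l} x_l$ and $\nu = \sum_{i,j} \nu^{i,j}\, x_i \otimes x_j$ all the coefficients $m_{i,j}^{l}$ and $\nu^{i,j}$ belong to $R$. If $R \subseteq K$ is a subring that is a unique factorization domain and $H$ admits a weak $R$-form, then $\frac{n}{k} \in R$. -/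

import Mathlib

open scoped TensorProduct

namespace HopfWeakForm

/-- `Λ` is a (left) integral of the Hopf algebra `H`: `h Λ = ε(h) Λ` for all `h`. (In a semisimple
Hopf algebra left and right integrals coincide.) -/
def IsHopfIntegral (K : Type*) {H : Type*} [Field K] [Ring H] [HopfAlgebra K H] (Λ : H) : Prop :=
  ∀ h : H, h * Λ = Coalgebra.counit (R := K) h • Λ

/-- The element `Σ Λ₁ ⊗ S(Λ₂)` of `H ⊗ H`. -/
noncomputable def nu (K : Type*) {H : Type*} [Field K] [Ring H] [HopfAlgebra K H] (Λ : H) :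
    H ⊗[K] H :=
  TensorProduct.map LinearMap.id (HopfAlgebra.antipode K) (Coalgebra.comul (R := K) Λ)

/-- `L` is an `R`-form of `(H, m, ν)`: it is the `R`-span of a `K`-basis `x₁, …, xₙ` of `H`
(hence free over `R` with basis `x₁, …, xₙ`) such that the coefficients of the products `xᵢ xⱼ`
with respect to the `xₗ`, and those of `ν` with respect to the `xᵢ ⊗ xⱼ`, lie in `R`. -/
def IsForm {K H : Type*} [Field K] [Ring H] [Algebra K H] (R : Subring K) (ν : H ⊗[K] H)
    (L : Submodule R H) : Prop :=
  ∃ x : Module.Basis (Fin (Module.finrank K H)) K H,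
    L = Submodule.span R (Set.range x) ∧
    (∀ i j l, x.repr (x i * x j) l ∈ R) ∧
    (∀ i j, (x.tensorProduct x).repr ν (i, j) ∈ R)

end HopfWeakForm

/-! Put `z = Σ χ(Λ₁) S(Λ₂)`, with `χ` the character of `M`. Then `z` acts on `M` as the scalar `n/k`
(`slice_character_smul`). Each `χ(xᵢ)` is integral over `R`, so `z` is a combination of the `xⱼ`
with coefficients in the integral closure `O`. Left multiplication by `z` thus has a matrix over
`O`, and its characteristic polynomial makes the eigenvalue `n/k` integral over `R`. A UFD is
integrally closed, so `n/k ∈ R`.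

The scalar comes from Schur's lemma for the Casimir element `ν`, together with `Σ S(Λ₂) Λ₁ = n`. The
latter needs `S² = 1`, the Larson–Radford theorem, which takes up most of the file. Contracting `ν`
with the sum of block traces gives a unit `U` implementing `S²`, and a Frobenius form `lam` dual to
`ν`. Radford's formula says that `S⁴` is conjugation by a group-like `g` of finite order. Hence a
power of `U` is scalar in every block, and `ε(Λ) lam(1) = Σ tr Uᵢ tr Uᵢ⁻¹` is a sum of squared
absolute values with no zero term. So `lam(1) ≠ 0`, which forces `g = 1` and `S⁴ = 1`. Two trace
computations then show that `lam(1)` is an integer and `tr S² = n lam(1)`, so `S² = ±1`, and `S(1) =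
1` fixes the sign. -/

namespace HopfWeakForm

/-! ### Convolution identities and the Casimir property of `ν`. -/

section HopfGeneral

open Coalgebra HopfAlgebra WithConv

variable {K H : Type*} [Field K] [Ring H] [HopfAlgebra K H]

/-- `h ↦ h ⊗ 1` as an element of the convolution algebra. -/
noncomputable def convLeft (K H : Type*) [Field K] [Ring H] [HopfAlgebra K H] :
    WithConv (H →ₗ[K] H ⊗[K] H) :=
  toConv ((TensorProduct.mk K H H).flip 1)

/-- `h ↦ 1 ⊗ h` as an element of the convolution algebra. -/
noncomputable def convRight (K H : Type*) [Field K] [Ring H] [HopfAlgebra K H] :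
    WithConv (H →ₗ[K] H ⊗[K] H) :=
  toConv (TensorProduct.mk K H H 1)

/-- `h ↦ S(h) ⊗ 1` as an element of the convolution algebra. -/
noncomputable def convLeftAntipode (K H : Type*) [Field K] [Ring H] [HopfAlgebra K H] :
    WithConv (H →ₗ[K] H ⊗[K] H) :=
  toConv ((TensorProduct.mk K H H).flip 1 ∘ₗ antipode K)

/-- `h ↦ 1 ⊗ S(h)` as an element of the convolution algebra. -/
noncomputable def convRightAntipode (K H : Type*) [Field K] [Ring H] [HopfAlgebra K H] :
    WithConv (H →ₗ[K] H ⊗[K] H) :=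
  toConv (TensorProduct.mk K H H 1 ∘ₗ antipode K)

/-- `h ↦ ε(h) c` as an element of the convolution algebra. -/
noncomputable def convConst {A : Type*} [Ring A] [Algebra K A] (c : A) :
    WithConv (H →ₗ[K] A) :=
  toConv ((LinearMap.toSpanSingleton K A c) ∘ₗ counit)

/-- Lets fixed tensors such as `ν` enter convolution identities, where the maps `h ↦ h ⊗ 1` and `h ↦
1 ⊗ h` can be cancelled. -/
theorem convConst_mul_apply {A : Type*} [Ring A] [Algebra K A] (c : A)
    (f : WithConv (H →ₗ[K] A)) (h : H) : (convConst (K := K) (H := H) c * f) h = c * f h := by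
  rw [(ℛ K h).convMul_apply]
  have : f h = ∑ i ∈ (ℛ K h).index, counit (R := K) ((ℛ K h).left i) • f ((ℛ K h).right i) := by
    conv_lhs => rw [← sum_counit_smul (ℛ K h)]
    exact (map_sum f.ofConv _ _).trans (Finset.sum_congr rfl fun i _ => map_smul f.ofConv _ _)
  rw [this, Finset.mul_sum]
  refine Finset.sum_congr rfl fun i _ => ?_
  simp [convConst]

theorem sum_counit_smul_left {a : H} {ι : Type*} (r : Repr K a ι) :
    ∑ i ∈ r.index, counit (R := K) (r.right i) • r.left i = a := by
  have := congr(TensorProduct.rid K H $(sum_tmul_counit_eq (R := K) r))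
  rwa [map_sum, TensorProduct.rid_tmul, one_smul] at this

theorem mul_convConst_apply {A : Type*} [Ring A] [Algebra K A] (c : A)
    (f : WithConv (H →ₗ[K] A)) (h : H) : (f * convConst (K := K) (H := H) c) h = f h * c := by
  rw [(ℛ K h).convMul_apply]
  have : f h = ∑ i ∈ (ℛ K h).index, counit (R := K) ((ℛ K h).right i) • f ((ℛ K h).left i) := by
    conv_lhs => rw [← sum_counit_smul_left (ℛ K h)]
    exact (map_sum f.ofConv _ _).trans (Finset.sum_congr rfl fun i _ => map_smul f.ofConv _ _)
  rw [this, Finset.sum_mul]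
  refine Finset.sum_congr rfl fun i _ => ?_
  simp [convConst]

theorem comul_eq_convMul :
    toConv (comul : H →ₗ[K] H ⊗[K] H) = convLeft K H * convRight K H := by
  ext h
  rw [(ℛ K h).convMul_apply]
  conv_lhs => simp [← (ℛ K h).eq]
  simp [convLeft, convRight]

theorem convLeft_mul_antipode : convLeft K H * convLeftAntipode K H = 1 := by
  ext h
  rw [(ℛ K h).convMul_apply]
  have := sum_mul_antipode_eq_smul (R := K) (ℛ K h)
  simp [convLeft, convLeftAntipode, ← TensorProduct.sum_tmul, this,
    Algebra.algebraMap_eq_smul_one, Algebra.TensorProduct.one_def, TensorProduct.smul_tmul']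

theorem convRight_mul_antipode : convRight K H * convRightAntipode K H = 1 := by
  ext h
  rw [(ℛ K h).convMul_apply]
  have := sum_mul_antipode_eq_smul (R := K) (ℛ K h)
  simp [convRight, convRightAntipode, ← TensorProduct.tmul_sum, this,
    Algebra.algebraMap_eq_smul_one, Algebra.TensorProduct.one_def]

theorem convRightAntipode_mul : convRightAntipode K H * convRight K H = 1 := by
  ext h
  rw [(ℛ K h).convMul_apply]
  have := sum_antipode_mul_eq_smul (R := K) (ℛ K h)
  simp [convRight, convRightAntipode, ← TensorProduct.tmul_sum, this,
    Algebra.algebraMap_eq_smul_one, Algebra.TensorProduct.one_def]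

theorem comul_antipode_mul_comul :
    toConv ((comul : H →ₗ[K] H ⊗[K] H) ∘ₗ antipode K) * toConv comul = 1 := by
  ext h
  rw [(ℛ K h).convMul_apply]
  have := sum_antipode_mul_eq_smul (R := K) (ℛ K h)
  simp [← Bialgebra.comul_mul, ← map_sum, this, Algebra.algebraMap_eq_smul_one]

/-- The antipode is anti-comultiplicative. -/
theorem comul_antipode (h : H) :
    comul (R := K) (antipode K h) =
      TensorProduct.map (antipode K) (antipode K) (TensorProduct.comm K H H (comul h)) := by
  have h1 : toConv (comul : H →ₗ[K] H ⊗[K] H) *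
      (convRightAntipode K H * convLeftAntipode K H) = 1 := by
    rw [comul_eq_convMul, mul_assoc, ← mul_assoc (convRight K H), convRight_mul_antipode, one_mul,
      convLeft_mul_antipode]
  -- `Δ ∘ S` and `h ↦ S(h₂) ⊗ S(h₁)` are both convolution inverses of `Δ`.
  have h2 := left_inv_eq_right_inv comul_antipode_mul_comul h1
  have h3 := congr($h2 h)
  rw [(ℛ K h).convMul_apply] at h3
  change comul (R := K) (antipode K h) = _ at h3
  rw [h3, ← (ℛ K h).eq]
  simp [convRightAntipode, convLeftAntipode]

/-- `p(a) b` for a tensor `a ⊗ b`. -/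
noncomputable def slice {A B : Type*} [Ring A] [Algebra K A] [Ring B] [Algebra K B]
    (p : A →ₗ[K] K) : A ⊗[K] B →ₗ[K] B :=
  (TensorProduct.lid K B).toLinearMap ∘ₗ p.rTensor B

@[simp]
theorem slice_tmul {A B : Type*} [Ring A] [Algebra K A] [Ring B] [Algebra K B]
    (p : A →ₗ[K] K) (a : A) (b : B) : slice p (a ⊗ₜ[K] b) = p a • b := by
  simp [slice]

section Slice

variable {A : Type*} [Ring A] [Algebra K A] (p : A →ₗ[K] K) (t : A ⊗[K] A) (h : A)

theorem slice_mul_one_tmul : slice p (t * 1 ⊗ₜ[K] h) = slice p t * h := by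
  induction t with
  | zero => simp
  | tmul a b => simp
  | add x y hx hy => simp [add_mul, hx, hy]

theorem slice_one_tmul_mul : slice p (1 ⊗ₜ[K] h * t) = h * slice p t := by
  induction t with
  | zero => simp
  | tmul a b => simp
  | add x y hx hy => simp [mul_add, hx, hy]

theorem slice_tmul_one_mul :
    slice p (h ⊗ₜ[K] 1 * t) = slice (p ∘ₗ LinearMap.mulLeft K h) t := by
  induction t with
  | zero => simp
  | tmul a b => simp
  | add x y hx hy => simp [mul_add, hx, hy]

theorem slice_mul_tmul_one :
    slice p (t * h ⊗ₜ[K] 1) = slice (p ∘ₗ LinearMap.mulRight K h) t := by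
  induction t with
  | zero => simp
  | tmul a b => simp
  | add x y hx hy => simp [add_mul, hx, hy]

end Slice

theorem nu_eq_sum {Λ : H} {ι : Type*} (r : Repr K Λ ι) :
    nu K Λ = ∑ i ∈ r.index, r.left i ⊗ₜ[K] antipode K (r.right i) := by
  simp [nu, ← r.eq]

theorem map_antipode_mul_left (t : H ⊗[K] H) (x y : H) :
    TensorProduct.map LinearMap.id (antipode K) (x ⊗ₜ[K] y * t) =
      x ⊗ₜ[K] 1 * TensorProduct.map LinearMap.id (antipode K) t * 1 ⊗ₜ[K] antipode K y := by
  induction t with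
  | zero => simp
  | tmul a b => simp [antipode_mul_antidistrib]
  | add x y hx hy => simp [mul_add, add_mul, hx, hy]

theorem map_antipode_mul_right (t : H ⊗[K] H) (x y : H) :
    TensorProduct.map LinearMap.id (antipode K) (t * x ⊗ₜ[K] y) =
      1 ⊗ₜ[K] antipode K y * TensorProduct.map LinearMap.id (antipode K) t * x ⊗ₜ[K] 1 := by
  induction t with
  | zero => simp
  | tmul a b => simp [antipode_mul_antidistrib]
  | add x y hx hy => simp [mul_add, add_mul, hx, hy]

/-- The Casimir property of `ν` for a left integral. -/
theorem IsHopfIntegral.tmul_one_mul_nu {Λ : H} (hΛ : IsHopfIntegral K Λ) (h : H) :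
    h ⊗ₜ[K] 1 * nu K Λ = nu K Λ * 1 ⊗ₜ[K] h := by
  -- Apply `id ⊗ S` to `Δ(x)Δ(Λ) = ε(x)Δ(Λ)`. Convolving with `1 ⊗ h` on the right then removes the
  -- antipode.
  have key : convLeft K H * convConst (nu K Λ) * convRightAntipode K H = convConst (nu K Λ) := by
    ext x
    have h1 : TensorProduct.map LinearMap.id (antipode K) (comul (R := K) (x * Λ)) =
        counit (R := K) x • nu K Λ := by
      rw [show x * Λ = _ from hΛ x]; simp [nu]
    rw [Bialgebra.comul_mul, ← (ℛ K x).eq, Finset.sum_mul, map_sum] at h1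
    simp_rw [map_antipode_mul_left] at h1
    rw [(ℛ K x).convMul_apply]
    simp_rw [mul_convConst_apply]
    exact h1
  have key2 : convLeft K H * convConst (nu K Λ) = convConst (nu K Λ) * convRight K H := by
    rw [← key, mul_assoc _ (convRightAntipode K H), convRightAntipode_mul, mul_one, key]
  have := congr($key2 h)
  rwa [mul_convConst_apply, convConst_mul_apply] at this

/-- Convolve `Δ(Λ)Δ(h) = ε(h)Δ(Λ)` on the right with `1 ⊗ S(h)`. -/
theorem comul_mul_tmul_one {Λ : H} (hΛ : ∀ h : H, Λ * h = counit (R := K) h • Λ) (h : H) :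
    comul (R := K) Λ * h ⊗ₜ[K] 1 = comul (R := K) Λ * 1 ⊗ₜ[K] antipode K h := by
  have key : convConst (comul (R := K) Λ) * toConv (comul : H →ₗ[K] H ⊗[K] H) =
      convConst (comul (R := K) Λ) := by
    ext x
    rw [convConst_mul_apply]
    change comul (R := K) Λ * comul (R := K) x = counit (R := K) x • comul (R := K) Λ
    rw [← Bialgebra.comul_mul, hΛ, map_smul]
  have key2 : convConst (comul (R := K) Λ) * convLeft K H =
      convConst (comul (R := K) Λ) * convRightAntipode K H := by
    conv_rhs => rw [← key]
    rw [comul_eq_convMul, mul_assoc, mul_assoc, convRight_mul_antipode, mul_one]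
  have := congr($key2 h)
  rwa [convConst_mul_apply, convConst_mul_apply] at this

theorem nu_mul_tmul_one {Λ : H} (hΛ : ∀ h : H, Λ * h = counit (R := K) h • Λ) (h : H) :
    nu K Λ * h ⊗ₜ[K] 1 = 1 ⊗ₜ[K] antipode K (antipode K h) * nu K Λ := by
  have := congr(TensorProduct.map LinearMap.id (antipode K) $(comul_mul_tmul_one hΛ h))
  rw [map_antipode_mul_right, map_antipode_mul_right, antipode_one,
    ← Algebra.TensorProduct.one_def, one_mul, mul_one] at this
  exact this

theorem mul_nu (Λ : H) : LinearMap.mul' K H (nu K Λ) = counit (R := K) Λ • 1 := by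
  rw [nu_eq_sum (ℛ K Λ)]
  simpa using sum_mul_antipode_eq_smul (R := K) (ℛ K Λ)

/-- Semisimple rings are semiprime. -/
theorem eq_zero_of_mul_mul_self {A : Type*} [Ring A] [IsSemisimpleRing A] (x : A)
    (hx : ∀ y, x * y * x = 0) : x = 0 := by
  obtain ⟨J, hJ⟩ := exists_isCompl (Ideal.span {x})
  have h1 : (1 : A) ∈ Ideal.span {x} ⊔ J := by rw [hJ.sup_eq_top]; trivial
  obtain ⟨y, hy, j, hj, hyj⟩ := Submodule.mem_sup.1 h1
  obtain ⟨a, rfl⟩ := Ideal.mem_span_singleton'.1 hy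
  have h2 : x = x * j := by
    have := congr(x * $hyj)
    rw [mul_add, ← mul_assoc, hx, zero_add, mul_one] at this
    exact this.symm
  have h3 : x ∈ Ideal.span {x} ⊓ J :=
    ⟨Ideal.mem_span_singleton_self x, by rw [h2]; exact J.mul_mem_left x hj⟩
  rw [hJ.inf_eq_bot] at h3
  simpa using h3

/-- In a semisimple Hopf algebra a left integral `Λ` with `ε(Λ) ≠ 0` is a right integral. -/
theorem IsHopfIntegral.mul_eq [IsSemisimpleRing H] {Λ : H} (hΛ : IsHopfIntegral K Λ) (h : H) :
    Λ * h = counit (R := K) h • Λ := by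
  have e1 : (h - counit (R := K) h • 1) * Λ = 0 := by
    rw [sub_mul, show h * Λ = _ from hΛ h, smul_one_mul, sub_self]
  have e2 : Λ * (h - counit (R := K) h • 1) = Λ * h - counit (R := K) h • Λ := by
    rw [mul_sub, mul_smul_one]
  rw [← sub_eq_zero, ← e2]
  -- Since `yΛ` is a multiple of `Λ` and `dΛ = 0`, every product `(Λd)y(Λd)` vanishes.
  refine eq_zero_of_mul_mul_self _ fun y => ?_
  set d := h - counit (R := K) h • (1 : H)
  calc Λ * d * y * (Λ * d) = Λ * d * (y * Λ) * d := by simp only [mul_assoc]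
    _ = 0 := by
      rw [show y * Λ = _ from hΛ y, mul_smul_comm, mul_assoc Λ d Λ, e1, mul_zero, smul_zero,
        zero_mul]

end HopfGeneral

/-! ### Matrix blocks and the trace form. -/

section Blocks

variable {K A ι : Type*} [Field K] [Ring A] [Algebra K A] [Fintype ι] {d : ι → ℕ}
  (e : A ≃ₐ[K] Π i, Matrix (Fin (d i)) (Fin (d i)) K)

/-- The sum of the traces of the blocks. -/
noncomputable def blockTrace : A →ₗ[K] K :=
  ∑ i, Matrix.traceLinearMap (Fin (d i)) K K ∘ₗ LinearMap.proj i ∘ₗ e.toLinearMap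

theorem blockTrace_apply (x : A) : blockTrace e x = ∑ i, (e x i).trace := by
  simp [blockTrace]

theorem blockTrace_mul_comm (x y : A) : blockTrace e (x * y) = blockTrace e (y * x) := by
  simp only [blockTrace_apply, map_mul, Pi.mul_apply]
  exact Finset.sum_congr rfl fun i _ => Matrix.trace_mul_comm _ _

variable [DecidableEq ι]

/-- The matrix units of the blocks. -/
noncomputable def blockUnit (i : ι) (p q : Fin (d i)) : A :=
  e.symm (Pi.single i (Matrix.single p q 1))

theorem blockTrace_blockUnit_mul (i : ι) (p q : Fin (d i)) (a : A) :
    blockTrace e (blockUnit e i q p * a) = e a i p q := by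
  rw [blockTrace_apply, Finset.sum_eq_single i]
  · simp [blockUnit, Matrix.trace_single_mul]
  · intro j _ hj
    simp [blockUnit, hj]
  · simp

/-- The matrix units `E_pq` and `E_qp` are dual bases for the trace form. -/
theorem sum_blockTrace_smul_blockUnit (a : A) :
    ∑ i, ∑ p, ∑ q, blockTrace e (blockUnit e i q p * a) • blockUnit e i p q = a := by
  apply e.injective
  simp only [map_sum, map_smul, blockTrace_blockUnit_mul]
  simp only [blockUnit, AlgEquiv.apply_symm_apply]
  ext i p q
  simp only [Finset.sum_apply, Pi.smul_apply]
  rw [Finset.sum_eq_single i]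
  · simp only [Pi.single_eq_same]
    conv_rhs => rw [Matrix.matrix_eq_sum_single (e a i)]
    simp
  · intro j _ hj
    simp [hj.symm]
  · simp

theorem mul'_eq_sum_slice (t : A ⊗[K] A) :
    LinearMap.mul' K A t = ∑ i, ∑ p, ∑ q, blockUnit e i p q *
      slice (blockTrace e ∘ₗ LinearMap.mulLeft K (blockUnit e i q p)) t := by
  induction t with
  | zero => simp
  | tmul a b =>
    simp only [LinearMap.mul'_apply, slice_tmul, LinearMap.comp_apply, LinearMap.mulLeft_apply,
      mul_smul_comm]
    conv_lhs => rw [← sum_blockTrace_smul_blockUnit e a]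
    simp only [Finset.sum_mul, smul_mul_assoc]
  | add x y hx hy => simp only [map_add, mul_add, Finset.sum_add_distrib, hx, hy]

theorem sum_single_mul_mul_single {n : ℕ} (M : Matrix (Fin n) (Fin n) K) :
    ∑ p, ∑ q, Matrix.single p q 1 * (M * Matrix.single q p 1) =
      M.trace • (1 : Matrix (Fin n) (Fin n) K) := by
  simp only [← mul_assoc, Matrix.single_mul_mul_single]
  rw [Matrix.trace, Finset.sum_smul, Finset.sum_comm]
  refine Finset.sum_congr rfl fun q _ => ?_
  rw [← Matrix.sum_single_one, Finset.smul_sum]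
  refine Finset.sum_congr rfl fun p _ => ?_
  simp

/-- For a Casimir tensor `t`, the trace of each block of `slice τ t` is read off from the product
of the legs of `t`. -/
theorem trace_slice_blockTrace {t : A ⊗[K] A} (ht : ∀ h : A, h ⊗ₜ[K] 1 * t = t * 1 ⊗ₜ[K] h)
    (i : ι) :
    (e (slice (blockTrace e) t) i).trace • (1 : Matrix (Fin (d i)) (Fin (d i)) K) =
      e (LinearMap.mul' K A t) i := by
  -- The Casimir property moves `h` to the second leg, so the dual-basis expansion becomes `Σ E_pq w
  -- E_qp = tr(w) · 1` in each block.
  have h1 (h : A) : slice (blockTrace e ∘ₗ LinearMap.mulLeft K h) t =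
      slice (blockTrace e) t * h := by
    rw [← slice_tmul_one_mul, ht, slice_mul_one_tmul]
  rw [mul'_eq_sum_slice e]
  simp only [h1, map_sum, map_mul, blockUnit, AlgEquiv.apply_symm_apply, Finset.sum_apply,
    Pi.mul_apply]
  rw [Finset.sum_eq_single i, ← sum_single_mul_mul_single]
  · simp
  · intro j _ hj
    simp [hj.symm]
  · simp

/-- A matrix of nonzero trace which intertwines all matrices with some map is invertible. -/
theorem isUnit_of_intertwining {n : ℕ} {u : Matrix (Fin n) (Fin n) K} (hu : u.trace ≠ 0)
    (h : ∀ X, ∃ Y, u * X = Y * u) : IsUnit u := by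
  rw [← Matrix.mulVec_injective_iff_isUnit, ← Matrix.coe_mulVecLin, ← LinearMap.ker_eq_bot,
    LinearMap.ker_eq_bot']
  intro v hv
  by_contra hv0
  obtain ⟨j, hj⟩ := Function.ne_iff.1 hv0
  apply hu
  -- If `u v = 0` and `v j ≠ 0`, then `u E_bj v = Y u v = 0`, while `E_bj v = v_j e_b`; so column
  -- `b` of `u` is zero.
  have : u = 0 := by
    ext a b
    obtain ⟨Y, hY⟩ := h (Matrix.single b j 1)
    have h2 : u.mulVec ((Matrix.single b j (1 : K)).mulVec v) = 0 := by
      rw [Matrix.mulVec_mulVec, hY, ← Matrix.mulVec_mulVec]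
      rw [Matrix.mulVecLin_apply] at hv
      rw [hv, Matrix.mulVec_zero]
    have h3 := congr_fun h2 a
    have h4 : (Matrix.single b j (1 : K)).mulVec v = Pi.single b (v j) := by
      rw [Matrix.single_mulVec, one_mul]
      rfl
    rw [h4, Matrix.mulVec_single] at h3
    simpa [show v j ≠ 0 from hj] using h3
  rw [this, Matrix.trace_zero]

end Blocks

/-! ### The unit implementing `S²` and the Frobenius form. -/

section Frobenius

open HopfAlgebra Coalgebra

variable {K H ι : Type*} [Field K] [Ring H] [HopfAlgebra K H]
  [Fintype ι] {d : ι → ℕ}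
  (e : H ≃ₐ[K] Π i, Matrix (Fin (d i)) (Fin (d i)) K)
  {Λ : H}

/-- Casimir turns `ν(1 ⊗ h)` into `(h ⊗ 1)ν`, the trace is cyclic, and `ν(h ⊗ 1) = (1 ⊗ S²h)ν`. -/
theorem IsHopfIntegral.slice_blockTrace_mul [IsSemisimpleRing H] (hΛ : IsHopfIntegral K Λ) (h : H) :
    slice (blockTrace e) (nu K Λ) * h =
      antipode K (antipode K h) * slice (blockTrace e) (nu K Λ) := by
  rw [← slice_mul_one_tmul, ← hΛ.tmul_one_mul_nu, slice_tmul_one_mul, ← slice_one_tmul_mul,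
    ← nu_mul_tmul_one hΛ.mul_eq, slice_mul_tmul_one]
  congr 2
  ext x
  exact blockTrace_mul_comm e _ _

theorem IsHopfIntegral.trace_slice (hΛ : IsHopfIntegral K Λ) [DecidableEq ι]
    [∀ i, NeZero (d i)] (i : ι) :
    (e (slice (blockTrace e) (nu K Λ)) i).trace = counit (R := K) Λ := by
  have := trace_slice_blockTrace e hΛ.tmul_one_mul_nu i
  rw [mul_nu, map_smul, map_one] at this
  simpa using congr_fun (congr_fun this 0) 0

theorem IsHopfIntegral.isUnit_slice [IsSemisimpleRing H] (hΛ : IsHopfIntegral K Λ)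
    [DecidableEq ι] [∀ i, NeZero (d i)] (h0 : counit (R := K) Λ ≠ 0) :
    IsUnit (slice (blockTrace e) (nu K Λ)) := by
  rw [← MulEquiv.isUnit_map e, Pi.isUnit_iff]
  intro i
  refine isUnit_of_intertwining (by rwa [hΛ.trace_slice]) fun X => ?_
  refine ⟨e (antipode K (antipode K (e.symm (Pi.single i X)))) i, ?_⟩
  have := congr(e $(hΛ.slice_blockTrace_mul e (e.symm (Pi.single i X))) i)
  simpa using this

/-- The Frobenius form of a split semisimple Hopf algebra dual to `ν`, and the element implementing
the square of the antipode. -/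
theorem IsHopfIntegral.exists_frobenius [IsSemisimpleRing H] (hΛ : IsHopfIntegral K Λ)
    [DecidableEq ι] [∀ i, NeZero (d i)] (h0 : counit (R := K) Λ ≠ 0) :
    ∃ (U : Hˣ) (lam : H →ₗ[K] K),
      (∀ h : H, antipode K (antipode K h) = U * h * ↑U⁻¹) ∧
      slice lam (nu K Λ) = 1 ∧
      (∀ x y, lam (x * y) = lam (antipode K (antipode K y) * x)) ∧
      (∀ i, (e (U : H) i).trace = counit (R := K) Λ) ∧
      lam 1 = ∑ i, (e (↑U⁻¹ : H) i).trace := by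
  obtain ⟨U, hU⟩ := hΛ.isUnit_slice e h0
  have hS (h : H) : antipode K (antipode K h) = U * h * ↑U⁻¹ := by
    rw [Units.eq_mul_inv_iff_mul_eq, hU, hΛ.slice_blockTrace_mul e h]
  -- Twisting by `U⁻¹` normalizes the form: by Casimir its contraction with `ν` is `U U⁻¹ = 1`.
  refine ⟨U, blockTrace e ∘ₗ LinearMap.mulLeft K (↑U⁻¹ : H), hS, ?_, ?_, ?_, ?_⟩
  · rw [← slice_tmul_one_mul, hΛ.tmul_one_mul_nu, slice_mul_one_tmul, ← hU, Units.mul_inv]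
  · intro x y
    simp only [LinearMap.comp_apply, LinearMap.mulLeft_apply, hS]
    rw [← mul_assoc, blockTrace_mul_comm]
    simp [mul_assoc]
  · intro i
    rw [hU, hΛ.trace_slice]
  · simp [blockTrace_apply]

end Frobenius

/-! ### Contractions of tensors and coassociativity. -/

section Slices

open HopfAlgebra Coalgebra

variable {K H : Type*} [Field K] [Ring H] [HopfAlgebra K H]

/-- `q(b) a` for a tensor `a ⊗ b`. -/
noncomputable def sliceRight (q : H →ₗ[K] K) : H ⊗[K] H →ₗ[K] H :=
  slice q ∘ₗ (TensorProduct.comm K H H).toLinearMap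

@[simp]
theorem sliceRight_tmul (q : H →ₗ[K] K) (a b : H) : sliceRight q (a ⊗ₜ[K] b) = q b • a := by
  simp [sliceRight]

theorem apply_slice_eq_apply_sliceRight (p q : H →ₗ[K] K) (t : H ⊗[K] H) :
    q (slice p t) = p (sliceRight q t) := by
  induction t with
  | zero => simp
  | tmul a b => simp [mul_comm]
  | add x y hx hy => simp [hx, hy]

theorem slice_map (p : H →ₗ[K] K) (f g : H →ₗ[K] H) (t : H ⊗[K] H) :
    slice p (TensorProduct.map f g t) = g (slice (p ∘ₗ f) t) := by
  induction t with
  | zero => simp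
  | tmul a b => simp
  | add x y hx hy => simp [hx, hy]

theorem slice_smul (c : K) (p : H →ₗ[K] K) (t : H ⊗[K] H) :
    slice (c • p) t = c • slice p t := by
  induction t with
  | zero => simp
  | tmul a b => simp [mul_smul]
  | add x y hx hy => simp [hx, hy]

theorem slice_sub (p q : H →ₗ[K] K) (t : H ⊗[K] H) :
    slice (p - q) t = slice p t - slice q t := by
  induction t with
  | zero => simp
  | tmul a b => simp [sub_smul]
  | add x y hx hy => simp only [map_add, hx, hy]; abel

theorem slice_comp_slice_comul (p q : H →ₗ[K] K) (h : H) :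
    slice (q ∘ₗ slice p ∘ₗ comul) (comul (R := K) h) =
      slice q (comul (R := K) (slice p (comul (R := K) h))) := by
  have h1 (x : H ⊗[K] H) (b : H) :
      slice q (slice p (TensorProduct.assoc K H H H (x ⊗ₜ[K] b))) = q (slice p x) • b := by
    induction x with
    | zero => simp
    | tmul a c => simp [mul_smul]
    | add x y hx hy => simp [TensorProduct.add_tmul, add_smul, hx, hy]
  have h2 (t : H ⊗[K] H) : slice (q ∘ₗ slice p ∘ₗ comul) t =
      slice q (slice p (TensorProduct.assoc K H H H (comul.rTensor H t))) := by
    induction t with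
    | zero => simp
    | tmul a b => simp [h1]
    | add x y hx hy => simp only [map_add, hx, hy]
  have h3 (t : H ⊗[K] H) : slice q (comul (R := K) (slice p t)) =
      slice q (slice p (comul.lTensor H t)) := by
    induction t with
    | zero => simp
    | tmul a b => simp
    | add x y hx hy => simp only [map_add, hx, hy]
  rw [h2, h3, coassoc_apply]

theorem comul_sliceRight (q : H →ₗ[K] K) (h : H) :
    comul (R := K) (sliceRight q (comul (R := K) h)) =
      (sliceRight q ∘ₗ comul).lTensor H (comul (R := K) h) := by
  have h1 (t : H ⊗[K] H) : comul (R := K) (sliceRight q t) =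
      (sliceRight q).lTensor H (TensorProduct.assoc K H H H (comul.rTensor H t)) := by
    induction t with
    | zero => simp
    | tmul a b =>
      simp only [sliceRight_tmul, map_smul, LinearMap.rTensor_tmul]
      induction comul (R := K) a with
      | zero => simp
      | tmul a c => simp
      | add x y hx hy => simp [TensorProduct.add_tmul, hx, hy]
    | add x y hx hy => simp only [map_add, hx, hy]
  rw [h1, coassoc_apply, LinearMap.lTensor_comp, LinearMap.comp_apply]

theorem counit_sliceRight_comul (q : H →ₗ[K] K) (h : H) :
    counit (R := K) (sliceRight q (comul (R := K) h)) = q h := by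
  rw [← apply_slice_eq_apply_sliceRight]
  congr 1
  rw [slice, LinearMap.comp_apply, rTensor_counit_comul]
  simp

theorem eq_of_forall_dual {x y : H} (h : ∀ q : H →ₗ[K] K, q x = q y) : x = y := by
  rw [← sub_eq_zero, ← Module.forall_dual_apply_eq_zero_iff K]
  intro q
  rw [map_sub, h q, sub_self]

end Slices

/-! ### Integrals on the dual, Radford's formula and trace formulas. -/

section Integrals

open HopfAlgebra Coalgebra

variable {K H : Type*} [Field K] [Ring H] [HopfAlgebra K H] {Λ : H} {lam : H →ₗ[K] K}

/-- Compute `S(Λ)Λ` twice: as `ε(Λ)Λ`, and, writing the second factor as `Λ = S(y)`, as `S(yΛ) =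
ε(Λ)S(Λ)`. -/
theorem IsHopfIntegral.antipode_eq [IsSemisimpleRing H] (hΛ : IsHopfIntegral K Λ)
    (h0 : counit (R := K) Λ ≠ 0)
    (hS : Function.Surjective (antipode K : H →ₗ[K] H)) : antipode K Λ = Λ := by
  have h1 : antipode K Λ * Λ = counit (R := K) Λ • Λ := by
    rw [hΛ, counit_antipode]
  have h2 : antipode K Λ * Λ = counit (R := K) Λ • antipode K Λ := by
    obtain ⟨y, hy⟩ := hS Λ
    conv_lhs => rw [← hy]
    rw [← antipode_mul_antidistrib, hy, hΛ, map_smul, ← counit_antipode, hy]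
  exact smul_right_injective H h0 (h2.symm.trans h1)

theorem IsHopfIntegral.slice_mulLeft (hΛ : IsHopfIntegral K Λ) (hlam : slice lam (nu K Λ) = 1)
    (h : H) : slice (lam ∘ₗ LinearMap.mulLeft K h) (nu K Λ) = h := by
  rw [← slice_tmul_one_mul, hΛ.tmul_one_mul_nu, slice_mul_one_tmul, hlam, one_mul]

theorem IsHopfIntegral.eq_zero_of_apply_mul (hΛ : IsHopfIntegral K Λ)
    (hlam : slice lam (nu K Λ) = 1) {z : H} (hz : ∀ y, lam (z * y) = 0) : z = 0 := by
  rw [← hΛ.slice_mulLeft hlam z, show lam ∘ₗ LinearMap.mulLeft K z = 0 from LinearMap.ext hz]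
  simp [slice]

theorem slice_comul_eq_one (hS : Function.Injective (antipode K : H →ₗ[K] H))
    (hlam : slice lam (nu K Λ) = 1) : slice lam (comul (R := K) Λ) = 1 := by
  apply hS
  rw [antipode_one, ← hlam, nu, slice_map, LinearMap.comp_id]

/-- The map `p ↦ p(Λ₁)Λ₂` from the dual to `H` is onto because `lam(S(h) ·)` is sent to `h`; the
dimensions agree. Forms can therefore be compared on `Δ(Λ)` alone. -/
theorem IsHopfIntegral.slice_comul_injective [FiniteDimensional K H] (hΛ : IsHopfIntegral K Λ)
    (hS : Function.Injective (antipode K : H →ₗ[K] H)) (hlam : slice lam (nu K Λ) = 1)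
    {p q : H →ₗ[K] K} (hpq : slice p (comul (R := K) Λ) = slice q (comul (R := K) Λ)) : p = q := by
  let G : Module.Dual K H →ₗ[K] H :=
    { toFun p := slice p (comul (R := K) Λ)
      map_add' p q := by
        have := slice_sub (p + q) q (comul (R := K) Λ)
        rw [add_sub_cancel_right] at this
        rw [this, sub_add_cancel]
      map_smul' c p := slice_smul c p _ }
  have hG : Function.Surjective G := fun h => by
    refine ⟨lam ∘ₗ LinearMap.mulLeft K (antipode K h), hS ?_⟩
    conv_rhs => rw [← hΛ.slice_mulLeft hlam (antipode K h)]
    rw [nu, slice_map, LinearMap.comp_id]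
    rfl
  exact (LinearMap.injective_iff_surjective_of_finrank_eq_finrank
    Subspace.dual_finrank_eq).2 hG hpq

/-- The form dual to `ν` is a right integral of the dual Hopf algebra. -/
theorem IsHopfIntegral.slice_comul_eq_smul [FiniteDimensional K H] (hΛ : IsHopfIntegral K Λ)
    (hS : Function.Injective (antipode K : H →ₗ[K] H)) (hlam : slice lam (nu K Λ) = 1) (h : H) :
    slice lam (comul (R := K) h) = lam h • 1 := by
  refine eq_of_forall_dual (K := K) fun q => ?_
  have h1 : q ∘ₗ slice lam ∘ₗ comul = q 1 • lam := by
    apply hΛ.slice_comul_injective hS hlam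
    rw [slice_comp_slice_comul, slice_smul, slice_comul_eq_one hS hlam, Bialgebra.comul_one,
      Algebra.TensorProduct.one_def, slice_tmul]
  have h2 := LinearMap.congr_fun h1 h
  simpa [mul_comm] using h2

theorem IsHopfIntegral.eq_smul_of_slice_comul [FiniteDimensional K H] (hΛ : IsHopfIntegral K Λ)
    (hS : Function.Injective (antipode K : H →ₗ[K] H)) (hlam : slice lam (nu K Λ) = 1)
    {p : H →ₗ[K] K} (hp : ∀ h, slice p (comul (R := K) h) = p h • 1) : p = p Λ • lam := by
  apply hΛ.slice_comul_injective hS hlam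
  rw [hp, slice_smul, slice_comul_eq_one hS hlam]

theorem IsHopfIntegral.apply_eq_one [FiniteDimensional K H] (hΛ : IsHopfIntegral K Λ)
    (hS : Function.Injective (antipode K : H →ₗ[K] H)) (hlam : slice lam (nu K Λ) = 1) :
    lam Λ = 1 := by
  have h1 := hΛ.slice_comul_eq_smul hS hlam Λ
  rw [slice_comul_eq_one hS hlam] at h1
  have h2 := congr(counit (R := K) $h1)
  rw [map_smul, Bialgebra.counit_one, smul_eq_mul, mul_one] at h2
  exact h2.symm

/-- The distinguished group-like element. -/
noncomputable def distinguished (Λ : H) (lam : H →ₗ[K] K) : H :=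
  sliceRight lam (comul (R := K) Λ)

/-- For every `q`, the form `h ↦ q(h₁) lam(h₂)` is again a right integral of the dual, hence a
multiple of `lam`; evaluating at `Λ` gives the factor `q(g)`. -/
theorem IsHopfIntegral.sliceRight_comul [FiniteDimensional K H] (hΛ : IsHopfIntegral K Λ)
    (hS : Function.Injective (antipode K : H →ₗ[K] H)) (hlam : slice lam (nu K Λ) = 1) (h : H) :
    sliceRight lam (comul (R := K) h) = lam h • distinguished Λ lam := by
  refine eq_of_forall_dual (K := K) fun q => ?_
  have h1 := hΛ.eq_smul_of_slice_comul hS hlam (p := lam ∘ₗ slice q ∘ₗ comul) fun h => by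
    rw [slice_comp_slice_comul, hΛ.slice_comul_eq_smul hS hlam]
    rfl
  have h2 := LinearMap.congr_fun h1 h
  simp only [LinearMap.comp_apply, apply_slice_eq_apply_sliceRight, LinearMap.smul_apply] at h2
  rw [h2, map_smul, distinguished, smul_eq_mul, smul_eq_mul, mul_comm]

theorem IsHopfIntegral.isGroupLikeElem_distinguished [FiniteDimensional K H]
    (hΛ : IsHopfIntegral K Λ)
    (hS : Function.Injective (antipode K : H →ₗ[K] H)) (hlam : slice lam (nu K Λ) = 1) :
    IsGroupLikeElem K (distinguished Λ lam) where
  counit_eq_one := by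
    rw [distinguished, counit_sliceRight_comul, hΛ.apply_eq_one hS hlam]
  comul_eq_tmul_self := by
    have h1 : sliceRight lam ∘ₗ comul =
        (LinearMap.toSpanSingleton K H (distinguished Λ lam)) ∘ₗ lam := by
      ext h
      simpa using hΛ.sliceRight_comul hS hlam h
    have h2 (t : H ⊗[K] H) : ((LinearMap.toSpanSingleton K H (distinguished Λ lam)) ∘ₗ lam).lTensor
        H t = sliceRight lam t ⊗ₜ[K] distinguished Λ lam := by
      induction t with
      | zero => simp
      | tmul a b => simp [TensorProduct.smul_tmul']
      | add x y hx hy => simp only [map_add, hx, hy, TensorProduct.add_tmul]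
    rw [distinguished, comul_sliceRight, h1, h2]
    rfl

theorem exists_pow_eq_one_of_isGroupLikeElem [FiniteDimensional K H] {g : H}
    (hg : IsGroupLikeElem K g) : ∃ N, 0 < N ∧ g ^ N = 1 := by
  have : Finite (Subtype (IsGroupLikeElem K : H → Prop)) :=
    (linearIndepOn_isGroupLikeElem (R := K) (A := H)).finite_of_isNoetherian
  have : Finite (GroupLike K H) := Finite.of_equiv _ GroupLike.valEquiv.symm
  obtain ⟨N, hN, h⟩ := isOfFinOrder_iff_pow_eq_one.1
    (isOfFinOrder_of_finite (⟨g, hg⟩ : GroupLike K H))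
  exact ⟨N, hN, congr(GroupLike.val $h)⟩

/-- The form `x ↦ lam(g S(x))` is a right integral of the dual, and its value at `Λ` is `lam(gΛ) =
1`, so it is `lam`. Substitute `y = S(x)` and use `lam ∘ S² = lam`. -/
theorem IsHopfIntegral.apply_distinguished_mul [FiniteDimensional K H] [IsSemisimpleRing H]
    (hΛ : IsHopfIntegral K Λ) (h0 : counit (R := K) Λ ≠ 0)
    (hS : Function.Bijective (antipode K : H →ₗ[K] H)) (hlam : slice lam (nu K Λ) = 1)
    (hlam2 : ∀ h : H, lam (antipode K (antipode K h)) = lam h) (y : H) :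
    lam (distinguished Λ lam * y) = lam (antipode K y) := by
  have hg := hΛ.isGroupLikeElem_distinguished hS.1 hlam
  set g := distinguished Λ lam with hgdef
  obtain ⟨N, hN, hgN⟩ := exists_pow_eq_one_of_isGroupLikeElem hg
  have hginj {x y : H} (h : g * x = g * y) : x = y := by
    have := congr(g ^ (N - 1) * $h)
    rwa [← mul_assoc, ← mul_assoc, ← pow_succ, Nat.sub_add_cancel hN, hgN, one_mul, one_mul]
      at this
  have h1 (y : H) : sliceRight (lam ∘ₗ LinearMap.mulLeft K g) (comul (R := K) y) =
      lam (g * y) • 1 := by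
    apply hginj
    have h2 (t : H ⊗[K] H) : g * sliceRight (lam ∘ₗ LinearMap.mulLeft K g) t =
        sliceRight lam (g ⊗ₜ[K] g * t) := by
      induction t with
      | zero => simp
      | tmul a b => simp
      | add x y hx hy => simp only [map_add, mul_add, hx, hy]
    rw [h2, ← hg.comul_eq_tmul_self, ← Bialgebra.comul_mul, hΛ.sliceRight_comul hS.1 hlam,
      mul_smul_comm, mul_one]
  have h3 := hΛ.eq_smul_of_slice_comul hS.1 hlam
    (p := lam ∘ₗ LinearMap.mulLeft K g ∘ₗ antipode K) fun h => by
      apply hS.1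
      have h4 := h1 (antipode K h)
      rw [comul_antipode, TensorProduct.map_comm, sliceRight, LinearMap.comp_apply,
        LinearEquiv.coe_coe, TensorProduct.comm_comm, slice_map] at h4
      rw [map_smul, antipode_one]
      exact h4
  obtain ⟨x, rfl⟩ := hS.2 y
  have h5 := LinearMap.congr_fun h3 x
  simp only [LinearMap.comp_apply, LinearMap.mulLeft_apply, LinearMap.smul_apply,
    hΛ.antipode_eq h0 hS.2] at h5
  rw [h5, hΛ, map_smul, hg.counit_eq_one, hΛ.apply_eq_one hS.1 hlam, hlam2]
  simp

/-- Radford's formula for the fourth power of the antipode, in the unimodular case. -/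
theorem IsHopfIntegral.distinguished_mul [FiniteDimensional K H] [IsSemisimpleRing H]
    (hΛ : IsHopfIntegral K Λ) (h0 : counit (R := K) Λ ≠ 0)
    (hS : Function.Bijective (antipode K : H →ₗ[K] H)) (hlam : slice lam (nu K Λ) = 1)
    (hN : ∀ x y : H, lam (x * y) = lam (antipode K (antipode K y) * x)) (x : H) :
    distinguished Λ lam * x =
      antipode K (antipode K (antipode K (antipode K x))) * distinguished Λ lam := by
  have hlam2 (h : H) : lam (antipode K (antipode K h)) = lam h := by
    simpa using (hN 1 h).symm
  have key := hΛ.apply_distinguished_mul h0 hS hlam hlam2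
  rw [← sub_eq_zero]
  -- By nondegeneracy it suffices that `lam(gxy) = lam(S(y)S(x)) = lam(S(y S²x)) = lam(g y S²x) =
  -- lam(S⁴(x) g y)`.
  refine hΛ.eq_zero_of_apply_mul hlam fun y => ?_
  rw [sub_mul, map_sub, sub_eq_zero, mul_assoc, mul_assoc, key, antipode_mul_antidistrib, hN,
    ← antipode_mul_antidistrib, ← key, ← mul_assoc, hN]

theorem IsHopfIntegral.distinguished_eq_one [FiniteDimensional K H]
    (hΛ : IsHopfIntegral K Λ)
    (hS : Function.Injective (antipode K : H →ₗ[K] H)) (hlam : slice lam (nu K Λ) = 1)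
    (h1 : lam 1 ≠ 0) : distinguished Λ lam = 1 := by
  have := hΛ.sliceRight_comul hS hlam 1
  rw [Bialgebra.comul_one, Algebra.TensorProduct.one_def, sliceRight_tmul] at this
  exact smul_right_injective H h1 this.symm

/-- The expansion `h = Σ lam(hΛ₁) S(Λ₂)` writes `φ` as a sum of rank-one maps. -/
theorem IsHopfIntegral.trace_eq (hΛ : IsHopfIntegral K Λ) [FiniteDimensional K H]
    (hlam : slice lam (nu K Λ) = 1) (φ : H →ₗ[K] H) {ι : Type*} (r : Repr K Λ ι) :
    LinearMap.trace K H φ =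
      ∑ i ∈ r.index, lam (φ (antipode K (r.right i)) * r.left i) := by
  have : φ = ∑ i ∈ r.index,
      (lam ∘ₗ LinearMap.mulRight K (r.left i)).smulRight (φ (antipode K (r.right i))) := by
    ext h
    have h1 := hΛ.slice_mulLeft hlam h
    rw [nu_eq_sum r, map_sum] at h1
    conv_lhs => rw [← h1]
    simp
  rw [this, map_sum]
  simp only [LinearMap.trace_smulRight]
  rw [← this]
  rfl

/-- A trace formula of Larson and Radford. -/
theorem IsHopfIntegral.trace_comp_slice [FiniteDimensional K H] [IsSemisimpleRing H]
    (hΛ : IsHopfIntegral K Λ) (h0 : counit (R := K) Λ ≠ 0)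
    (hS : Function.Bijective (antipode K : H →ₗ[K] H)) (hlam : slice lam (nu K Λ) = 1)
    {σ : H →ₗ[K] H} (hσ : ∀ h, antipode K (antipode K (σ h)) = h) (f : H →ₗ[K] K) :
    LinearMap.trace K H (σ ∘ₗ slice f ∘ₗ comul) = lam 1 * f Λ := by
  have hinv (h : H) : antipode K (σ (antipode K h)) = h := hS.1 (hσ _)
  -- Here `σ = S⁻²`, so `M(a ⊗ c) = S⁻¹(c)a`, and `M ∘ Δ = ε`.
  let M : H ⊗[K] H →ₗ[K] H := TensorProduct.lift
    ((LinearMap.mul K H).flip.compl₂ (σ ∘ₗ antipode K))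
  have hM (a c : H) : M (a ⊗ₜ c) = σ (antipode K c) * a := by simp [M]
  have hM1 (x : H) : M (comul (R := K) x) = counit (R := K) x • 1 := by
    apply hS.1
    rw [map_smul, antipode_one, ← sum_antipode_mul_eq_smul (ℛ K x)]
    conv_lhs => rw [← (ℛ K x).eq]
    simp only [map_sum, hM, antipode_mul_antidistrib, hinv]
  have hf (c : H) : slice f (comul (R := K) (antipode K c)) =
      antipode K (sliceRight (f ∘ₗ antipode K) (comul (R := K) c)) := by
    rw [comul_antipode, slice_map]
    rfl
  have h1 := congr(lam (M $(comul_sliceRight (f ∘ₗ antipode K) Λ)))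
  rw [hM1, counit_sliceRight_comul, ← (ℛ K Λ).eq] at h1
  simp only [map_sum, LinearMap.lTensor_tmul, hM, map_smul, LinearMap.comp_apply,
    hΛ.antipode_eq h0 hS.2] at h1
  rw [hΛ.trace_eq hlam _ (ℛ K Λ), mul_comm, ← smul_eq_mul, h1]
  simp only [LinearMap.comp_apply, hf]

end Integrals

/-! ### Traces of finite-order matrices and positivity. -/

section Positivity

variable {K : Type*} [Field K]

theorem trace_eq_finrank_range_of_isIdempotentElem {V : Type*} [AddCommGroup V] [Module K V]
    [FiniteDimensional K V] {f : V →ₗ[K] V} (hf : IsIdempotentElem f) :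
    LinearMap.trace K V f = (Module.finrank K (LinearMap.range f) : K) :=
  (LinearMap.IsIdempotentElem.isProj_range f hf).trace

/-- The spectral decomposition of a matrix of finite order. -/
theorem exists_trace_pow_eq_sum [CharZero K] {n m : ℕ} (hm : 0 < m) {ω : K}
    (hω : IsPrimitiveRoot ω m) {w : Matrix (Fin n) (Fin n) K} (hw : w ^ m = 1) :
    ∃ c : ℕ → ℕ, ∀ j, (w ^ j).trace = ∑ k ∈ Finset.range m, (c k : K) * (ω ^ k) ^ j := by
  have hω0 : ω ≠ 0 := hω.ne_zero hm.ne'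
  have hm0 : (m : K) ≠ 0 := Nat.cast_ne_zero.2 hm.ne'
  let v (k : ℕ) : Matrix (Fin n) (Fin n) K := (ω ^ k)⁻¹ • w
  -- The projector onto the `ω ^ k`-eigenspace of `w`; its trace, a rank, is the multiplicity `c k`.
  let P (k : ℕ) : Matrix (Fin n) (Fin n) K := (m : K)⁻¹ • ∑ j ∈ Finset.range m, v k ^ j
  have hv (k : ℕ) : v k ^ m = 1 := by
    rw [smul_pow, hw, inv_pow, ← pow_mul, mul_comm, pow_mul, hω.pow_eq_one]
    simp
  have hvP (k : ℕ) : v k * P k = P k := by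
    have := mul_geom_sum (v k) m
    rw [hv, sub_self, sub_mul, one_mul, sub_eq_zero] at this
    rw [mul_smul_comm, this]
  have hwP (k : ℕ) : w * P k = ω ^ k • P k := by
    conv_rhs => rw [← hvP]
    rw [← smul_mul_assoc, smul_inv_smul₀ (pow_ne_zero _ hω0)]
  have hvP' (k j : ℕ) : v k ^ j * P k = P k := by
    induction j with
    | zero => simp
    | succ j ih => rw [pow_succ, mul_assoc, hvP, ih]
  have hwP' (k j : ℕ) : w ^ j * P k = (ω ^ k) ^ j • P k := by
    induction j with
    | zero => simp
    | succ j ih => rw [pow_succ, mul_assoc, hwP, mul_smul_comm, ih, smul_smul, pow_succ']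
  have hPP (k : ℕ) : IsIdempotentElem (P k) := by
    change P k * P k = P k
    conv_lhs => lhs; simp only [P]
    rw [smul_mul_assoc, Finset.sum_mul]
    simp only [hvP', Finset.sum_const, Finset.card_range]
    rw [← Nat.cast_smul_eq_nsmul K, inv_smul_smul₀ hm0]
  have hsum : ∑ k ∈ Finset.range m, P k = 1 := by
    simp only [P, ← Finset.smul_sum]
    rw [Finset.sum_comm, Finset.sum_eq_single 0]
    · simp only [pow_zero, Finset.sum_const, Finset.card_range]
      rw [← Nat.cast_smul_eq_nsmul K, inv_smul_smul₀ hm0]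
    · intro j hj hj0
      have hj1 : (ω ^ j)⁻¹ ≠ 1 := by
        rw [Ne, inv_eq_one]
        exact hω.pow_ne_one_of_pos_of_lt hj0 (Finset.mem_range.1 hj)
      have hj2 : ∑ k ∈ Finset.range m, (ω ^ j)⁻¹ ^ k = 0 := by
        have := mul_geom_sum (ω ^ j)⁻¹ m
        rw [inv_pow, ← pow_mul, mul_comm j, pow_mul, hω.pow_eq_one, one_pow, inv_one, sub_self]
          at this
        exact (mul_eq_zero.1 this).resolve_left (sub_ne_zero.2 hj1)
      simp only [v, smul_pow, ← Finset.sum_smul]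
      convert zero_smul K (w ^ j)
      rw [← hj2]
      refine Finset.sum_congr rfl fun k _ => ?_
      rw [inv_pow, inv_pow, ← pow_mul, ← pow_mul, mul_comm]
    · simp [hm.ne']
  have htr (k : ℕ) : ∃ c : ℕ, (P k).trace = c := by
    have h1 : IsIdempotentElem (Matrix.toLin' (P k)) := by
      change Matrix.toLin' (P k) ∘ₗ Matrix.toLin' (P k) = _
      rw [← Matrix.toLin'_mul, (hPP k).eq]
    exact ⟨_, by rw [← Matrix.trace_toLin'_eq, trace_eq_finrank_range_of_isIdempotentElem h1]⟩
  choose c hc using htr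
  refine ⟨c, fun j => ?_⟩
  rw [← mul_one (w ^ j), ← hsum, Finset.mul_sum, Matrix.trace_sum]
  refine Finset.sum_congr rfl fun k _ => ?_
  rw [hwP', Matrix.trace_smul, hc, smul_eq_mul, mul_comm]

/-- Sums of squared absolute values of nonnegative combinations of roots of unity do not vanish,
over any field of characteristic zero. -/
theorem eq_zero_of_sum_mul_inv_eq_zero [CharZero K] {m : ℕ} (hm : 0 < m) {ω : K}
    (hω : IsPrimitiveRoot ω m) {ι : Type*} [Fintype ι] (c : ι → ℕ → ℕ)
    (h : ∑ i, (∑ k ∈ Finset.range m, (c i k : K) * ω ^ k) *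
      (∑ k ∈ Finset.range m, (c i k : K) * (ω ^ k)⁻¹) = 0) (i : ι) :
    ∑ k ∈ Finset.range m, (c i k : K) * ω ^ k = 0 := by
  -- The relation lives among algebraic numbers, which embed in `ℂ`, where inverting roots of unity
  -- is complex conjugation.
  have halg : IsAlgebraic ℚ ω := (hω.isIntegral hm).tower_top.isAlgebraic
  let ω' : algebraicClosure ℚ K := ⟨ω, mem_algebraicClosure_iff.2 halg⟩
  have hω' : IsPrimitiveRoot ω' m :=
    IsPrimitiveRoot.of_map_of_injective (f := algebraMap (algebraicClosure ℚ K) K) hω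
      (algebraMap (algebraicClosure ℚ K) K).injective
  have : Algebra.IsAlgebraic ℚ (algebraicClosure ℚ K) := algebraicClosure.isAlgebraic ℚ K
  let φ : algebraicClosure ℚ K →ₐ[ℚ] ℂ := IsAlgClosed.lift
  have hφ : IsPrimitiveRoot (φ ω') m := hω'.map_of_injective φ.toRingHom.injective
  have hconj (k : ℕ) : (φ ω' ^ k)⁻¹ = starRingEnd ℂ (φ ω' ^ k) := by
    rw [Complex.inv_def, Complex.normSq_eq_norm_sq, norm_pow, hφ.norm'_eq_one hm.ne']
    simp
  have h1 : ∑ i, (∑ k ∈ Finset.range m, (c i k : algebraicClosure ℚ K) * ω' ^ k) *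
      (∑ k ∈ Finset.range m, (c i k : algebraicClosure ℚ K) * (ω' ^ k)⁻¹) = 0 := by
    apply (algebraMap (algebraicClosure ℚ K) K).injective
    simpa [ω'] using h
  have h2 := congr(φ $h1)
  simp only [map_sum, map_mul, map_natCast, map_inv₀, map_pow, map_zero] at h2
  simp only [hconj] at h2
  have h3 (i : ι) : ∑ k ∈ Finset.range m, (c i k : ℂ) * starRingEnd ℂ (φ ω' ^ k) =
      starRingEnd ℂ (∑ k ∈ Finset.range m, (c i k : ℂ) * φ ω' ^ k) := by simp
  simp only [h3, Complex.mul_conj] at h2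
  rw [← Complex.ofReal_sum, Complex.ofReal_eq_zero,
    Finset.sum_eq_zero_iff_of_nonneg fun _ _ => Complex.normSq_nonneg _] at h2
  have h4 := Complex.normSq_eq_zero.1 (h2 i (Finset.mem_univ i))
  have h5 : ∑ k ∈ Finset.range m, (c i k : algebraicClosure ℚ K) * ω' ^ k = 0 := by
    apply φ.toRingHom.injective
    simpa using h4
  simpa [ω'] using congr(algebraMap (algebraicClosure ℚ K) K $h5)

/-- Dividing `u i` by an `m`-th root of `s i` gives a matrix of finite order and leaves each product
unchanged. The products are then squared absolute values of nonzero sums of roots of unity. -/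
theorem sum_trace_mul_trace_inv_ne_zero [CharZero K] [IsAlgClosed K] {ι : Type*} [Fintype ι]
    [Nonempty ι] {d : ι → ℕ} {m : ℕ} (hm : 0 < m)
    (u u' : Π i, Matrix (Fin (d i)) (Fin (d i)) K) (hu : ∀ i, u i * u' i = 1) (s : ι → K)
    (hs : ∀ i, s i ≠ 0) (hpow : ∀ i, u i ^ m = s i • 1) (htr : ∀ i, (u i).trace ≠ 0) :
    ∑ i, (u i).trace * (u' i).trace ≠ 0 := by
  have : NeZero (m : K) := ⟨Nat.cast_ne_zero.2 hm.ne'⟩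
  obtain ⟨ω, hω⟩ := HasEnoughRootsOfUnity.exists_primitiveRoot K m
  choose a ha using fun i => IsAlgClosed.exists_pow_nat_eq (s i) hm
  have ha0 (i : ι) : a i ≠ 0 := by
    rintro h
    exact hs i (by rw [← ha i, h, zero_pow hm.ne'])
  let w (i : ι) := (a i)⁻¹ • u i
  have hw (i : ι) : w i ^ m = 1 := by
    rw [smul_pow, hpow, smul_smul, inv_pow, ha, inv_mul_cancel₀ (hs i), one_smul]
  choose c hc using fun i => exists_trace_pow_eq_sum hm hω (hw i)
  have hu1 (i : ι) : u i = a i • w i := (smul_inv_smul₀ (ha0 i) _).symm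
  have hu2 (i : ι) : u' i = (a i)⁻¹ • w i ^ (m - 1) := by
    have h1 : (a i)⁻¹ • w i ^ (m - 1) * u i = 1 := by
      rw [hu1, smul_mul_smul_comm, inv_mul_cancel₀ (ha0 i), one_smul, ← pow_succ,
        Nat.sub_add_cancel hm, hw]
    exact (left_inv_eq_right_inv h1 (hu i)).symm
  have hprod (i : ι) : (u i).trace * (u' i).trace =
      (∑ k ∈ Finset.range m, (c i k : K) * ω ^ k) *
      (∑ k ∈ Finset.range m, (c i k : K) * (ω ^ k)⁻¹) := by
    have e1 := hc i 1
    have e2 := hc i (m - 1)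
    simp only [pow_one] at e1
    have e3 (k : ℕ) : (ω ^ k) ^ (m - 1) = (ω ^ k)⁻¹ := by
      refine eq_inv_of_mul_eq_one_left ?_
      rw [← pow_succ, Nat.sub_add_cancel hm, ← pow_mul, mul_comm, pow_mul, hω.pow_eq_one, one_pow]
    simp only [e3] at e2
    rw [hu2, Matrix.trace_smul, ← e1, ← e2]
    conv_lhs => rw [hu1, Matrix.trace_smul]
    rw [smul_eq_mul, smul_eq_mul, mul_mul_mul_comm, mul_inv_cancel₀ (ha0 i), one_mul]
  intro h
  simp only [hprod] at h
  obtain ⟨i⟩ := ‹Nonempty ι›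
  have h1 := eq_zero_of_sum_mul_inv_eq_zero hm hω c h i
  have e1 := hc i 1
  simp only [pow_one] at e1
  apply htr i
  rw [hu1, Matrix.trace_smul, e1, h1, smul_zero]

end Positivity

/-! ### The regular character. -/

section RegularCharacter

open HopfAlgebra Coalgebra

variable {K H : Type*} [Field K] [Ring H] [HopfAlgebra K H]

/-- The character of the regular representation. -/
noncomputable def regularTrace (K H : Type*) [Field K] [Ring H] [Algebra K H] : H →ₗ[K] K :=
  LinearMap.trace K H ∘ₗ LinearMap.mul K H

theorem regularTrace_apply (h : H) :
    regularTrace K H h = LinearMap.trace K H (LinearMap.mulLeft K h) := rfl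

theorem regularTrace_mul_comm (x y : H) :
    regularTrace K H (x * y) = regularTrace K H (y * x) := by
  rw [regularTrace_apply, regularTrace_apply, LinearMap.mulLeft_mul, LinearMap.mulLeft_mul]
  exact LinearMap.trace_mul_comm K _ _

variable [FiniteDimensional K H]

/-- Multiplication by the coproduct of `h` on `H ⊗ H` is conjugate to multiplication by `h` on the
left factor. -/
theorem trace_mulLeft_comul (h : H) :
    LinearMap.trace K (H ⊗[K] H) (LinearMap.mulLeft K (comul (R := K) h)) =
      regularTrace K H h * Module.finrank K H := by
  let Φ : H ⊗[K] H →ₗ[K] H ⊗[K] H := TensorProduct.lift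
    ((LinearMap.mul K (H ⊗[K] H)).compl₁₂ comul (TensorProduct.mk K H H 1))
  have hΦ (x y : H) : Φ (x ⊗ₜ y) = comul (R := K) x * 1 ⊗ₜ y := by simp [Φ]
  have hsurj : Function.Surjective Φ := by
    intro t
    induction t with
    | zero => exact ⟨0, map_zero _⟩
    | add x y hx hy =>
      obtain ⟨a, rfl⟩ := hx
      obtain ⟨b, rfl⟩ := hy
      exact ⟨a + b, map_add _ _ _⟩
    | tmul x y =>
      have h1 : WithConv.toConv (comul : H →ₗ[K] H ⊗[K] H) * convRightAntipode K H =
          convLeft K H := by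
        rw [comul_eq_convMul, mul_assoc, convRight_mul_antipode, mul_one]
      have h2 := congr($h1 x)
      rw [(ℛ K x).convMul_apply] at h2
      refine ⟨∑ i ∈ (ℛ K x).index, (ℛ K x).left i ⊗ₜ (antipode K ((ℛ K x).right i) * y), ?_⟩
      have h3 : (convLeft K H) x * 1 ⊗ₜ y = x ⊗ₜ[K] y := by simp [convLeft]
      rw [← h3, ← h2, map_sum, Finset.sum_mul]
      refine Finset.sum_congr rfl fun i _ => ?_
      rw [hΦ, mul_assoc]
      simp [convRightAntipode]
  let E : (H ⊗[K] H) ≃ₗ[K] (H ⊗[K] H) :=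
    LinearEquiv.ofBijective Φ ⟨LinearMap.injective_iff_surjective.2 hsurj, hsurj⟩
  have hE : LinearMap.mulLeft K (comul (R := K) h) =
      E.conj (TensorProduct.map (LinearMap.mulLeft K h) LinearMap.id) := by
    rw [LinearEquiv.conj_apply, LinearEquiv.eq_comp_toLinearMap_symm]
    ext x y
    change comul (R := K) h * Φ (x ⊗ₜ y) = Φ ((h * x) ⊗ₜ y)
    rw [hΦ, hΦ, Bialgebra.comul_mul, mul_assoc]
  rw [hE, LinearMap.trace_conj', LinearMap.trace_tensorProduct', LinearMap.trace_id]
  rfl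

/-- Both sides are the trace of `Δ(h)` acting on `H ⊗ H`: one leg at a time, or through the
conjugation to `h ⊗ 1`. -/
theorem regularTrace_slice_comul (h : H) :
    regularTrace K H (slice (regularTrace K H) (comul (R := K) h)) =
      Module.finrank K H * regularTrace K H h := by
  rw [mul_comm, ← trace_mulLeft_comul h]
  induction comul (R := K) h with
  | zero => simp
  | add x y hx hy =>
    rw [map_add, map_add, hx, hy, ← map_add]
    congr 1
    ext
    simp [add_mul]
  | tmul a b =>
    rw [slice_tmul, map_smul, smul_eq_mul]
    have : LinearMap.mulLeft K (a ⊗ₜ[K] b) =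
        TensorProduct.map (LinearMap.mulLeft K a) (LinearMap.mulLeft K b) := by
      ext x y
      simp
    rw [this, LinearMap.trace_tensorProduct']
    rfl

theorem regularTrace_integral {Λ : H} (hΛ : ∀ h : H, Λ * h = counit (R := K) h • Λ) :
    regularTrace K H Λ = counit (R := K) Λ := by
  have : LinearMap.mulLeft K Λ = (counit : H →ₗ[K] K).smulRight Λ := by
    ext h
    simpa using hΛ h
  change LinearMap.trace K H (LinearMap.mulLeft K Λ) = _
  rw [this, LinearMap.trace_smulRight]

end RegularCharacter

/-! ### Traces of involutions. -/

section Involutions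

variable {K V : Type*} [Field K] [CharZero K] [AddCommGroup V] [Module K V]
  [FiniteDimensional K V]

/-- The trace of an involution times a commuting idempotent is an integer. -/
theorem exists_trace_mul_eq_intCast {σ P : V →ₗ[K] V} (hσ : σ * σ = 1) (hP : P * P = P)
    (hσP : σ * P = P * σ) : ∃ z : ℤ, LinearMap.trace K V (σ * P) = z := by
  have h2 : (2 : K) ≠ 0 := two_ne_zero
  -- Used for `σ` and `-σ`: `σP` is the difference of the idempotents `(P ± σP)/2`, so its trace is
  -- a difference of ranks.
  have aux (τ : V →ₗ[K] V) (hτ : τ * τ = 1) (hτP : τ * P = P * τ) :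
      IsIdempotentElem ((2 : K)⁻¹ • (P + τ * P)) := by
    have e1 : τ * P * P = τ * P := by rw [mul_assoc, hP]
    have e2 : P * (τ * P) = τ * P := by rw [← mul_assoc, ← hτP, e1]
    have e3 : τ * P * (τ * P) = P := by rw [mul_assoc, e2, ← mul_assoc, hτ, one_mul]
    change (2 : K)⁻¹ • (P + τ * P) * (2 : K)⁻¹ • (P + τ * P) = _
    rw [smul_mul_smul_comm, add_mul, mul_add, mul_add, hP, e1, e2, e3,
      show P + τ * P + (τ * P + P) = (2 : K) • (P + τ * P) by rw [two_smul]; abel, smul_smul,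
      mul_assoc, inv_mul_cancel₀ h2, mul_one]
  have h3 := trace_eq_finrank_range_of_isIdempotentElem (aux σ hσ hσP)
  have h4 := trace_eq_finrank_range_of_isIdempotentElem
    (aux (-σ) (by rw [neg_mul_neg, hσ]) (by rw [neg_mul, mul_neg, hσP]))
  have h5 : σ * P = (2 : K)⁻¹ • (P + σ * P) - (2 : K)⁻¹ • (P + -σ * P) := by
    rw [← smul_sub, neg_mul, add_sub_add_left_eq_sub, sub_neg_eq_add, ← two_smul K,
      inv_smul_smul₀ h2]
  rw [h5, map_sub, h3, h4]
  exact ⟨(Module.finrank K (LinearMap.range ((2 : K)⁻¹ • (P + σ * P))) : ℤ) -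
    Module.finrank K (LinearMap.range ((2 : K)⁻¹ • (P + -σ * P))), by push_cast; rfl⟩

/-- An involution whose trace is a nonzero integer multiple of the dimension is `±1`. -/
theorem eq_one_or_neg_one_of_trace_eq {σ : V →ₗ[K] V} (hσ : σ * σ = 1) {z : ℤ} (hz : z ≠ 0)
    (htr : LinearMap.trace K V σ = Module.finrank K V * z) : σ = 1 ∨ σ = -1 := by
  have h2 : (2 : K) ≠ 0 := two_ne_zero
  have hidem : IsIdempotentElem ((2 : K)⁻¹ • (1 - σ)) := by
    change (2 : K)⁻¹ • (1 - σ) * (2 : K)⁻¹ • (1 - σ) = _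
    rw [smul_mul_smul_comm, mul_sub, mul_one, sub_mul, one_mul, hσ,
      show 1 - σ - (σ - 1) = (2 : K) • (1 - σ) by rw [two_smul]; abel, smul_smul,
      mul_assoc, inv_mul_cancel₀ h2, mul_one]
  have h3 := trace_eq_finrank_range_of_isIdempotentElem hidem
  set r := Module.finrank K (LinearMap.range ((2 : K)⁻¹ • (1 - σ))) with hr
  have hrle : r ≤ Module.finrank K V := Submodule.finrank_le _
  rw [map_smul, map_sub, LinearMap.trace_one, htr, smul_eq_mul, inv_mul_eq_iff_eq_mul₀ h2] at h3
  have h4 : (Module.finrank K V : ℤ) - Module.finrank K V * z = 2 * r := by exact_mod_cast h3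
  -- With `r` the multiplicity of `-1`, `dim V · (1 - z) = 2r` and `0 ≤ r ≤ dim V`; a nonzero
  -- integer `z` leaves only the extremes.
  have h5 : r = 0 ∨ r = Module.finrank K V := by
    rcases lt_or_gt_of_ne hz with h | h
    · right; nlinarith
    · left; nlinarith
  rcases h5 with h5 | h5
  · left
    rw [hr, Submodule.finrank_eq_zero, LinearMap.range_eq_bot,
      smul_eq_zero_iff_right (inv_ne_zero h2),
      sub_eq_zero] at h5
    exact h5.symm
  · right
    have h6 : LinearMap.range ((2 : K)⁻¹ • (1 - σ)) = ⊤ := Submodule.eq_top_of_finrank_eq h5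
    have h7 : (2 : K)⁻¹ • (1 - σ) = 1 := by
      ext x
      obtain ⟨y, rfl⟩ : x ∈ LinearMap.range ((2 : K)⁻¹ • (1 - σ)) := h6 ▸ Submodule.mem_top
      exact LinearMap.congr_fun hidem y
    have h8 : 1 - σ = (2 : K) • 1 := by
      conv_rhs => rw [← h7, smul_inv_smul₀ h2]
    rw [two_smul, sub_eq_iff_eq_add, add_assoc, left_eq_add, add_comm] at h8
    exact eq_neg_of_add_eq_zero_left h8

end Involutions

/-! ### The antipode is an involution. -/

section LarsonRadford

open HopfAlgebra Coalgebra

variable {K H : Type*} [Field K] [CharZero K] [IsAlgClosed K] [Ring H] [HopfAlgebra K H]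
  [FiniteDimensional K H] [IsSemisimpleRing H]

/-- **Larson–Radford**: the antipode of a semisimple Hopf algebra in characteristic zero is an
involution. -/
theorem IsHopfIntegral.antipode_antipode {Λ : H} (hΛ : IsHopfIntegral K Λ)
    (hn : counit (R := K) Λ = (Module.finrank K H : K)) (h : H) :
    antipode K (antipode K h) = h := by
  have : Nontrivial H := by
    refine ⟨0, 1, fun h01 => ?_⟩
    simpa using congr(counit (R := K) $h01)
  have hnpos : 0 < Module.finrank K H := Module.finrank_pos
  have hn0 : (Module.finrank K H : K) ≠ 0 := Nat.cast_ne_zero.2 hnpos.ne'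
  have h0 : counit (R := K) Λ ≠ 0 := by rwa [hn]
  obtain ⟨l, d, hd, ⟨e⟩⟩ := IsSemisimpleRing.exists_algEquiv_pi_matrix_of_isAlgClosed K H
  obtain ⟨U, lam, hU, hlam, hnak, htrU, hlam1⟩ := hΛ.exists_frobenius e h0
  have hS2 : Function.Bijective fun h : H => antipode K (antipode K h) := by
    simp only [hU]
    refine ⟨fun x y hxy => ?_, fun x => ⟨↑U⁻¹ * x * U, by simp [mul_assoc]⟩⟩
    simpa using hxy
  have hS : Function.Bijective (antipode K : H →ₗ[K] H) :=
    ⟨hS2.1.of_comp, hS2.2.of_comp⟩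
  have hg := hΛ.isGroupLikeElem_distinguished hS.1 hlam
  have hgx := hΛ.distinguished_mul h0 hS hlam hnak
  have hgone := hΛ.distinguished_eq_one hS.1 hlam
  set g := distinguished Λ lam
  have hne : Nonempty (Fin l) := by
    by_contra hempty
    rw [not_nonempty_iff] at hempty
    exact one_ne_zero (e.injective (Subsingleton.elim (e (1 : H)) (e 0)))
  have hlam0 : lam 1 ≠ 0 := by
    obtain ⟨N, hN, hgN⟩ := exists_pow_eq_one_of_isGroupLikeElem hg
    -- `U²` and `g` both implement `S⁴`, so `z` is central and scalar in each block. As `g ^ N = 1`,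
    -- the power `U ^ (2N)` is then scalar in each block.
    obtain ⟨z, hz⟩ : ∃ z : H, z = ↑U⁻¹ * ↑U⁻¹ * g := ⟨_, rfl⟩
    have hUz : (U : H) * U * z = g := by rw [hz]; simp [mul_assoc]
    have hzc (x : H) : z * x = x * z := by
      rw [hz, mul_assoc, hgx, hU, hU]
      simp [mul_assoc]
    have hblock (i : Fin l) : ∃ c : K, e z i = c • 1 := by
      obtain ⟨c, hc⟩ := Matrix.mem_range_scalar_iff_commute_single'.2 fun p q => by
        have := congr(e $(hzc (e.symm (Pi.single i (Matrix.single p q 1)))) i)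
        simpa [Commute, SemiconjBy] using this.symm
      exact ⟨c, by rw [← hc, Matrix.smul_one_eq_diagonal]; rfl⟩
    choose c hc using hblock
    have hpow (i : Fin l) : e (U : H) i ^ (2 * N) * (c i ^ N • 1) = 1 := by
      have h1 : ((U : H) * U) ^ N * z ^ N = 1 := by
        have : Commute ((U : H) * U) z := (hzc _).symm
        rw [← this.mul_pow, hUz, hgN]
      have h2 := congr(e $h1 i)
      simp only [map_mul, map_pow, map_one, Pi.mul_apply, Pi.pow_apply, Pi.one_apply, hc,
        smul_pow, one_pow] at h2
      rw [pow_mul, pow_two]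
      exact h2
    have hc0 (i : Fin l) : c i ^ N ≠ 0 := by
      intro h
      have := hpow i
      rw [h, zero_smul, mul_zero] at this
      exact one_ne_zero this.symm
    have key := sum_trace_mul_trace_inv_ne_zero (m := 2 * N) (by positivity)
      (fun i => e (U : H) i) (fun i => e (↑U⁻¹ : H) i)
      (fun i => by
        have := congr(e $(U.mul_inv) i)
        simpa only [map_mul, map_one, Pi.mul_apply, Pi.one_apply] using this)
      (fun i => (c i ^ N)⁻¹)
      (fun i => inv_ne_zero (hc0 i))
      (fun i => by
        have := hpow i
        rw [mul_smul_comm, mul_one] at this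
        rw [← this, inv_smul_smul₀ (hc0 i)])
      (fun i => by rwa [htrU])
    simp only [htrU, ← Finset.mul_sum, ← hlam1] at key
    exact right_ne_zero_of_mul key
  have hS4 (x : H) : antipode K (antipode K (antipode K (antipode K x))) = x := by
    have := hgx x
    rw [hgone hlam0, one_mul, mul_one] at this
    exact this.symm
  let σ : H →ₗ[K] H := antipode K ∘ₗ antipode K
  have hσ : σ * σ = 1 := LinearMap.ext hS4
  let r := regularTrace K H
  let T : H →ₗ[K] H := slice r ∘ₗ comul
  have htr (f : H →ₗ[K] K) := hΛ.trace_comp_slice h0 hS hlam (σ := σ) hS4 f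
  have hTT : T * T = (Module.finrank K H : K) • T := by
    ext x
    change slice r (comul (R := K) (slice r (comul (R := K) x))) = _
    rw [← slice_comp_slice_comul]
    have : r ∘ₗ slice r ∘ₗ comul = (Module.finrank K H : K) • r :=
      LinearMap.ext regularTrace_slice_comul
    rw [this, slice_smul]
    rfl
  have hrσ : r ∘ₗ σ = r := by
    ext x
    change regularTrace K H (antipode K (antipode K x)) = regularTrace K H x
    rw [hU, regularTrace_mul_comm]
    simp
  have hσT : σ * T = T * σ := by
    ext x
    change σ (slice r (comul (R := K) x)) = slice r (comul (R := K) (antipode K (antipode K x)))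
    rw [comul_antipode, comul_antipode, ← TensorProduct.map_comm, TensorProduct.comm_comm,
      slice_map, slice_map]
    conv_lhs => rw [← hrσ]
    rfl
  let P : H →ₗ[K] H := (Module.finrank K H : K)⁻¹ • T
  have hP : P * P = P := by
    rw [smul_mul_smul_comm, hTT, smul_smul, mul_assoc, inv_mul_cancel₀ hn0, mul_one]
  -- The trace formula with `f = r` identifies this integer as `lam(1) r(Λ)/n = lam(1)`; with `f =
  -- ε` it gives `tr σ = n lam(1)`.
  obtain ⟨z, hz⟩ := exists_trace_mul_eq_intCast hσ hP (by rw [mul_smul_comm, smul_mul_assoc, hσT])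
  have hlamz : lam 1 = z := by
    rw [← hz, mul_smul_comm, map_smul]
    have := htr r
    rw [regularTrace_integral hΛ.mul_eq, hn] at this
    rw [show LinearMap.trace K H (σ * T) = _ from this, smul_eq_mul, mul_comm (lam 1),
      inv_mul_cancel_left₀ hn0]
  have htrσ : LinearMap.trace K H σ = Module.finrank K H * z := by
    have h1 := htr counit
    have h2 : slice counit ∘ₗ comul = (LinearMap.id : H →ₗ[K] H) := by
      ext x
      change slice counit (comul (R := K) x) = x
      rw [slice, LinearMap.comp_apply, rTensor_counit_comul]
      simp
    rw [h2, LinearMap.comp_id, hn, hlamz, mul_comm] at h1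
    exact h1
  rcases eq_one_or_neg_one_of_trace_eq hσ (by rintro rfl; simp [hlam0] at hlamz) htrσ with h1 | h1
  · exact LinearMap.congr_fun h1 h
  · have h2 : antipode K (antipode K (1 : H)) = -1 := LinearMap.congr_fun h1 1
    rw [antipode_one, antipode_one, eq_neg_iff_add_eq_zero, one_add_one_eq_two] at h2
    have h3 := congr(counit (R := K) $h2)
    rw [← one_add_one_eq_two, map_add, Bialgebra.counit_one, map_zero, one_add_one_eq_two] at h3
    exact absurd h3 two_ne_zero

end LarsonRadford

/-! ### The action of the contracted Casimir element on a simple module. -/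

section Character

open HopfAlgebra Coalgebra

variable {K H M : Type*} [Field K] [Ring H]
    [AddCommGroup M] [Module K M] [Module H M]

section Algebra

variable [Algebra K H] [IsScalarTower K H M]

variable (K H M) in
/-- The character of the `H`-module `M`. -/
noncomputable def character : H →ₗ[K] K :=
  LinearMap.trace K M ∘ₗ (Algebra.lsmul K K M).toLinearMap

theorem character_apply (h : H) :
    character K H M h = LinearMap.trace K M (Algebra.lsmul K K M h) := rfl

/-- The averaging map `a ⊗ b ↦ (m ↦ a Y (b m))`. -/
noncomputable def average (Y : M →ₗ[K] M) : H ⊗[K] H →ₗ[K] Module.End K M :=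
  TensorProduct.lift ((LinearMap.mul K (Module.End K M)).compl₁₂
    (LinearMap.mulRight K (Y : Module.End K M) ∘ₗ (Algebra.lsmul K K M).toLinearMap)
    (Algebra.lsmul K K M).toLinearMap)

theorem average_tmul (Y : M →ₗ[K] M) (a b : H) (m : M) :
    average Y (a ⊗ₜ[K] b) m = a • Y (b • m) := by
  simp [average]

theorem average_mul_left (Y : M →ₗ[K] M) (h : H) (t : H ⊗[K] H) (m : M) :
    average Y (h ⊗ₜ[K] 1 * t) m = h • average Y t m := by
  induction t with
  | zero => simp
  | tmul a b => simp [average_tmul, mul_smul]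
  | add x y hx hy => simp [mul_add, hx, hy]

theorem average_mul_right (Y : M →ₗ[K] M) (h : H) (t : H ⊗[K] H) (m : M) :
    average Y (t * 1 ⊗ₜ[K] h) m = average Y t (h • m) := by
  induction t with
  | zero => simp
  | tmul a b => simp [average_tmul, mul_smul]
  | add x y hx hy => simp [add_mul, hx, hy]

theorem trace_average (Y : M →ₗ[K] M) (t : H ⊗[K] H) :
    LinearMap.trace K M (average Y t) =
      LinearMap.trace K M (Y * Algebra.lsmul K K M
        (LinearMap.mul' K H (TensorProduct.comm K H H t))) := by
  induction t with
  | zero => simp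
  | tmul a b =>
    have : average Y (a ⊗ₜ[K] b) =
        Algebra.lsmul K K M a * (Y * Algebra.lsmul K K M b) := by
      ext m
      rw [average_tmul]
      rfl
    rw [this, LinearMap.trace_mul_comm]
    simp [mul_assoc]
  | add x y hx hy => simp only [map_add, mul_add, hx, hy]

/-- The Casimir property makes the average `H`-linear, and Schur's lemma applies. -/
theorem exists_average_eq_smul [IsAlgClosed K] [IsSimpleModule H M] [FiniteDimensional K M]
    (Y : M →ₗ[K] M) {t : H ⊗[K] H} (ht : ∀ h : H, h ⊗ₜ[K] 1 * t = t * 1 ⊗ₜ[K] h) :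
    ∃ c : K, average Y t = c • 1 := by
  let G : M →ₗ[H] M :=
    { toFun := average Y t
      map_add' := map_add _
      map_smul' h m := by
        rw [← average_mul_right, ← ht, average_mul_left]
        rfl }
  obtain ⟨c, hc⟩ := (IsSimpleModule.algebraMap_end_bijective_of_isAlgClosed (A := H) (V := M) K).2 G
  refine ⟨c, ?_⟩
  ext m
  exact (LinearMap.congr_fun hc m).symm

/-- Expanding `χ` as a sum of diagonal coefficients reduces the action to averages of rank-one maps,
which Schur's lemma evaluates. -/
theorem apply_slice_character_smul [FiniteDimensional K M] {ι : Type*} [Fintype ι]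
    (B : Module.Basis ι K M) (ψ : M →ₗ[K] K) (t : H ⊗[K] H) (m : M) :
    ψ (slice (character K H M) t • m) =
      ∑ p, B.coord p (average (ψ.smulRight (B p)) t m) := by
  classical
  induction t with
  | zero => simp
  | tmul a b =>
    have h1 : character K H M a = ∑ p, B.coord p (a • B p) := by
      rw [character_apply, LinearMap.trace_eq_matrix_trace K B, Matrix.trace]
      simp [LinearMap.toMatrix_apply]
    rw [slice_tmul, smul_assoc, map_smul, h1, smul_eq_mul, Finset.sum_mul]
    refine Finset.sum_congr rfl fun p _ => ?_
    rw [average_tmul, LinearMap.smulRight_apply, smul_algebra_smul_comm, LinearMap.map_smul,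
      smul_eq_mul, mul_comm]
  | add x y hx hy =>
    simp only [map_add, add_smul, hx, hy, LinearMap.add_apply, Finset.sum_add_distrib]

end Algebra

/-- In a semisimple Hopf algebra, `χ(a) b` acts on the simple module of character `χ` by `n / k`,
where `ν = a ⊗ b`. -/
theorem IsHopfIntegral.slice_character_smul [CharZero K] [IsAlgClosed K] [HopfAlgebra K H]
    [FiniteDimensional K H] [IsSemisimpleRing H] [IsScalarTower K H M] [IsSimpleModule H M]
    [FiniteDimensional K M]
    {Λ : H} (hΛ : IsHopfIntegral K Λ)
    (hn : counit (R := K) Λ = (Module.finrank K H : K)) (m : M) :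
    slice (character K H M) (nu K Λ) • m =
      ((Module.finrank K H : K) / (Module.finrank K M : K)) • m := by
  have hS := hΛ.antipode_antipode hn
  have : Nontrivial M := IsSimpleModule.nontrivial H M
  have hk0 : (Module.finrank K M : K) ≠ 0 := Nat.cast_ne_zero.2 Module.finrank_pos.ne'
  -- The one place where `S² = 1` enters: `S(S(Λ₂)Λ₁) = S(Λ₁)S²(Λ₂) = S(Λ₁)Λ₂`.
  have hflip : LinearMap.mul' K H (TensorProduct.comm K H H (nu K Λ)) =
      (Module.finrank K H : K) • 1 := by
    apply Function.LeftInverse.injective hS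
    rw [nu_eq_sum (ℛ K Λ), map_smul, antipode_one, ← hn,
      ← sum_antipode_mul_eq_smul (R := K) (ℛ K Λ)]
    simp [antipode_mul_antidistrib, hS]
  have havg (Y : M →ₗ[K] M) : average Y (nu K Λ) =
      ((Module.finrank K H : K) / (Module.finrank K M : K) * LinearMap.trace K M Y) • 1 := by
    obtain ⟨c, hc⟩ := exists_average_eq_smul Y hΛ.tmul_one_mul_nu
    have h1 := trace_average Y (nu K Λ)
    rw [hc, hflip, map_smul, LinearMap.trace_one, map_smul, map_one, mul_smul_comm, mul_one,
      map_smul, smul_eq_mul, smul_eq_mul] at h1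
    rw [hc, div_mul_eq_mul_div, ← h1, mul_div_cancel_right₀ _ hk0]
  let B := Module.finBasis K M
  rw [← sub_eq_zero, ← Module.forall_dual_apply_eq_zero_iff K]
  intro ψ
  rw [map_sub, sub_eq_zero, apply_slice_character_smul B]
  simp only [havg, LinearMap.trace_smulRight, LinearMap.smul_apply, Module.End.one_apply, map_smul]
  conv_rhs => rw [← B.sum_repr m, map_sum, Finset.smul_sum]
  refine Finset.sum_congr rfl fun p _ => ?_
  simp only [map_smul, smul_eq_mul, Module.Basis.coord_apply]
  ring

end Character

/-! ### Integrality over subrings. -/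

section Integrality

open Polynomial

variable {K A : Type*} [Field K] [Ring A] [Algebra K A]

/-- Cayley–Hamilton for left multiplication by `h`, evaluated at `1`. -/
theorem exists_monic_aeval_eq_zero {O : Type*} [CommRing O] [Algebra O K] {n : Type*} [Fintype n]
    [DecidableEq n] (x : Module.Basis n K A) {h : A}
    (hx : ∀ l i, x.repr (h * x l) i ∈ (algebraMap O K).range) :
    ∃ f : O[X], f.Monic ∧ aeval h (f.map (algebraMap O K)) = 0 := by
  choose N hN using hx
  have : FiniteDimensional K A := Module.Basis.finiteDimensional_of_finite x
  let N' : Matrix n n O := Matrix.of fun i l => N l i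
  have hN' : N'.map (algebraMap O K) = LinearMap.toMatrix x x (LinearMap.mulLeft K h) := by
    ext i l
    simp [N', hN, LinearMap.toMatrix_apply]
  refine ⟨N'.charpoly, Matrix.charpoly_monic _, ?_⟩
  have h1 := LinearMap.aeval_self_charpoly (LinearMap.mulLeft K h)
  rw [← LinearMap.charpoly_toMatrix _ x, ← hN', Matrix.charpoly_map] at h1
  have h2 := LinearMap.congr_fun h1 1
  rw [show LinearMap.mulLeft K h = Algebra.lmul K A h from rfl, aeval_algHom_apply] at h2
  simpa using h2

theorem isIntegral_of_hasEigenvalue {V O : Type*} [AddCommGroup V] [Module K V] [CommRing O]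
    [Algebra O K] {φ : Module.End K V} {f : O[X]} (hf : f.Monic)
    (hφ : aeval φ (f.map (algebraMap O K)) = 0) {μ : K} (hμ : φ.HasEigenvalue μ) :
    IsIntegral O μ := by
  obtain ⟨v, hv⟩ := hμ.exists_hasEigenvector
  have h1 := Module.End.aeval_apply_of_hasEigenvector (p := f.map (algebraMap O K)) hv
  rw [hφ, LinearMap.zero_apply, eq_comm, smul_eq_zero_iff_left hv.2, eval_map] at h1
  exact ⟨f, hf, h1⟩

theorem isIntegral_trace_of_aeval_eq_zero [IsAlgClosed K] {V O : Type*} [AddCommGroup V]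
    [Module K V] [FiniteDimensional K V] [CommRing O]
    [Algebra O K] {φ : Module.End K V} {f : O[X]} (hf : f.Monic)
    (hφ : aeval φ (f.map (algebraMap O K)) = 0) : IsIntegral O (LinearMap.trace K V φ) := by
  rw [Module.End.trace_eq_sum_roots_charpoly_of_splits (IsAlgClosed.splits _)]
  refine IsIntegral.multiset_sum fun μ hμ => isIntegral_of_hasEigenvalue hf hφ ?_
  rw [Module.End.hasEigenvalue_iff_isRoot_charpoly]
  exact isRoot_of_mem_roots hμ

/-- Integral closedness concerns only the fraction field, so the quotient is first formed there and
then embedded in `K`. -/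
theorem mem_of_isIntegral_div (R : Subring K) [IsIntegrallyClosed R] {a b : K} (ha : a ∈ R)
    (hb : b ∈ R) (h : IsIntegral R (a / b)) : a / b ∈ R := by
  let : Algebra (FractionRing R) K := FractionRing.liftAlgebra R K
  let y : FractionRing R := algebraMap R _ ⟨a, ha⟩ / algebraMap R _ ⟨b, hb⟩
  have hy : algebraMap (FractionRing R) K y = a / b := by
    rw [map_div₀, ← IsScalarTower.algebraMap_apply, ← IsScalarTower.algebraMap_apply]
    rfl
  rw [← hy, isIntegral_algebraMap_iff (algebraMap (FractionRing R) K).injective] at h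
  obtain ⟨r, hr⟩ := IsIntegrallyClosed.isIntegral_iff.1 h
  rw [← hy, ← hr, ← IsScalarTower.algebraMap_apply]
  exact r.2

end Integrality

end HopfWeakForm

theorem theorem2 {K H M : Type*} [Field K] [IsAlgClosed K] [CharZero K]
    [Ring H] [HopfAlgebra K H] [FiniteDimensional K H] [IsSemisimpleRing H]
    [AddCommGroup M] [Module K M] [Module H M] [IsScalarTower K H M] [IsSimpleModule H M]
    (Λ : H) (hΛ : HopfWeakForm.IsHopfIntegral K Λ)
    (hΛn : Coalgebra.counit (R := K) Λ = (Module.finrank K H : K))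
    (R : Subring K) [UniqueFactorizationMonoid R]
    (hR : ∃ L : Submodule R H, HopfWeakForm.IsForm R (HopfWeakForm.nu K Λ) L) :
    (Module.finrank K H : K) / (Module.finrank K M : K) ∈ R := by
  open HopfWeakForm in
  obtain ⟨-, x, -, hmul, hν⟩ := hR
  have : Module.Finite K M := Module.Finite.trans H M
  have : Nontrivial M := IsSimpleModule.nontrivial H M
  refine mem_of_isIntegral_div R (natCast_mem R _) (natCast_mem R _) ?_
  let χ := character K H M
  let O := integralClosure R K
  have hχ (i) : χ (x i) ∈ (algebraMap O K).range := by
    obtain ⟨f, hf, hfx⟩ := exists_monic_aeval_eq_zero (O := R) x (h := x i)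
      fun l q => ⟨⟨_, hmul i l q⟩, rfl⟩
    have h1 : IsIntegral R (χ (x i)) :=
      isIntegral_trace_of_aeval_eq_zero (φ := Algebra.lsmul K K M (x i)) hf
        (by rw [Polynomial.aeval_algHom_apply, hfx, map_zero])
    exact ⟨⟨_, h1⟩, rfl⟩
  have hRO {c : K} (hc : c ∈ R) : c ∈ (algebraMap O K).range :=
    ⟨algebraMap R O ⟨c, hc⟩, rfl⟩
  have hz : slice χ (nu K Λ) =
      ∑ i, ∑ j, ((x.tensorProduct x).repr (nu K Λ) (i, j) * χ (x i)) • x j := by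
    conv_lhs => rw [← (x.tensorProduct x).sum_repr (nu K Λ), Fintype.sum_prod_type]
    simp only [map_sum, map_smul, Module.Basis.tensorProduct_apply, slice_tmul, smul_smul]
  obtain ⟨f, hf, hfz⟩ := exists_monic_aeval_eq_zero (O := O) x (h := slice χ (nu K Λ)) fun l q => by
    rw [hz]
    simp only [Finset.sum_mul, map_sum, smul_mul_assoc, map_smul, Finsupp.coe_finsetSum,
      Finset.sum_apply, Finsupp.smul_apply, smul_eq_mul]
    exact sum_mem fun i _ => sum_mem fun j _ =>
      mul_mem (mul_mem (hRO (hν i j)) (hχ i)) (hRO (hmul j l q))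
  -- `n/k` is an eigenvalue of `z` on `M`, hence integral over `O`, and `O` is integral over `R`.
  refine isIntegral_trans (A := O) _ (isIntegral_of_hasEigenvalue
    (φ := Algebra.lsmul K K M (slice χ (nu K Λ))) hf
    (by rw [Polynomial.aeval_algHom_apply, hfz, map_zero]) ?_)
  obtain ⟨m, hm⟩ := exists_ne (0 : M)
  exact Module.End.hasEigenvalue_of_hasEigenvector
    ⟨Module.End.mem_eigenspace_iff.2 (hΛ.slice_character_smul hΛn m), hm⟩
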